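/- **Quantizer.** For a dynamic range $\rho>0$ and a bit budget $B\in\mathbb N$, $B\ge 1$, put $\Delta=\frac{2\rho}{2^B-1}$ and $q_j=-\rho+(j-1)\Delta$ for $j=1,\dots,2^B$. For $|x|\le\rho$ let $j$ be the largest index with $q_j\le x$; the uniformly dithered quantizer $\mathrm Q_{\rho,B}(x)$ takes the value $q_{j+1}$ with probability $r=\frac{x-q_j}{\Delta}$ and $q_j$ with probability $1-r$. A matrix is quantized entrywise, with independent dithers; the quantizer is saturated if some entry of its input lies outside $[-\rho,\rho]$. **Algorithm (LPLR-SVD).** Let $A\in\mathbb R^{n\times d}$ have a full singular value decomposition $A=U\Sigma V^\top$ with singular values $\sigma_1\ge\sigma_2\ge\cdots\ge 0$, and let $\widetilde U_k\in\mathbb R^{n\times k}$ consist of the first $k$ columns of $U\Sigma$. Given quantizers $\mathrm Q$ and $\mathrm Q'$ with bit budgets $B$ and $B'$, put $L=\mathrm Q(\widetilde U_k)$, let $W^*=W^*(L)\in\mathbb R^{k\times d}$ be a minimizer of $\|LW-A\|_F^2$ (for instance $W^*=L^\dagger A$), and put $R=\mathrm Q'(W^*)$, with dithers independent of those of $\mathrm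 Q$. If $\mathrm Q$ or $\mathrm Q'$ is saturated, the algorithm returns $L=0$, $R=0$ instead. **Theorem.** There is an absolute constant $C>0$ such that the following holds. Let $A\in\mathbb R^{n\times d}$ have rows $a^{(i)}$ with $\|a^{(i)}\|_2\le \mathrm R$ for all $i$, where $\mathrm R>0$. Let $1\le k\le\min(n,d)$ with $\sigma_k>0$, let $A_k$ be a best rank-$k$ approximation of $A$ in Frobenius norm (among matrices of rank at most $k$), and let $\kappa(A_k)=\sigma_1/\sigma_k$. Let $0<\epsilon<4k\sigma_1^2$. Run LPLR-SVD, with any full singular value decomposition of $A$ and any choice of the least-squares minimizer $W^*(L)$, with dynamic ranges $\sigma_1$ for $\mathrm Q$ and $2\kappa(A_k)$ for $\mathrm Q'$, and bit budgets satisfying $B\ge\max\{B_1,B_2\}$ and $$B'\ \ge\ \log_2\Bigl(4\sigma_1\kappa(A_k)\sqrt{\tfrac{dk}{\epsilon}}+1\Bigr),$$ where $$B_1=\log_2\Bigl(2\sigma_1\sqrt{\tfrac{nk}{\epsilon}}+1\Bigr),\qquad B_2=\log_2\Bigl(\tfrac{4C\kappa(A_k)}{\log 2}\Bigl(\sqrt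 n+\sqrt k+\sqrt{\log\bigl(\tfrac{8n\mathrm R^2}{\epsilon}\bigr)}\Bigr)+1\Bigr),$$ with the innermost square root read as $0$ if $8n\mathrm R^2<\epsilon$. Then $$\mathbb E\,\|LR-A\|_F^2\ \le\ \|A_k-A\|_F^2+\epsilon,$$ where the expectation is over the dithers of $\mathrm Q$ and $\mathrm Q'$. -/

import Mathlib

open scoped ENNReal Matrix.Norms.Frobenius

namespace LPLR

noncomputable section

/-! ### Singular values, singular value decompositions, best low-rank approximations -/

/-- The singular values of `A` in non-increasing order, indexed from zero: in the usual notation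
`singularValue A i` is `σ_{i+1}` (and it is `0` for `i ≥ rank A`). -/
def singularValue {n d : ℕ} (A : Matrix (Fin n) (Fin d) ℝ) (i : ℕ) : ℝ :=
  (Matrix.toEuclideanLin A).singularValues i

/-- The rectangular diagonal factor `Σ` of the full singular value decomposition of `A`. -/
def sigmaMatrix {n d : ℕ} (A : Matrix (Fin n) (Fin d) ℝ) : Matrix (Fin n) (Fin d) ℝ :=
  Matrix.of fun i j => if (i : ℕ) = (j : ℕ) then singularValue A i else 0

/-- `A = U Σ Vᵀ` is a full singular value decomposition. -/
structure IsSVD {n d : ℕ} (A : Matrix (Fin n) (Fin d) ℝ) (U : Matrix (Fin n) (Fin n) ℝ)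
    (V : Matrix (Fin d) (Fin d) ℝ) : Prop where
  left_orthogonal : U ∈ Matrix.orthogonalGroup (Fin n) ℝ
  right_orthogonal : V ∈ Matrix.orthogonalGroup (Fin d) ℝ
  eq_mul : A = U * sigmaMatrix A * V.transpose

/-- The first `k` columns of `U Σ`, i.e. the top-`k` left singular vectors scaled by the
corresponding singular values. -/
def scaledLeftFactor {n d k : ℕ} (A : Matrix (Fin n) (Fin d) ℝ) (U : Matrix (Fin n) (Fin n) ℝ)
    (hk : k ≤ d) : Matrix (Fin n) (Fin k) ℝ :=
  (U * sigmaMatrix A).submatrix id (Fin.castLE hk)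

/-- `Ak` is a best rank-`k` approximation of `A` in Frobenius norm. -/
structure IsBestRankApprox {n d : ℕ} (A : Matrix (Fin n) (Fin d) ℝ) (k : ℕ)
    (Ak : Matrix (Fin n) (Fin d) ℝ) : Prop where
  rank_le : Ak.rank ≤ k
  norm_le : ∀ M : Matrix (Fin n) (Fin d) ℝ, M.rank ≤ k → ‖Ak - A‖ ≤ ‖M - A‖

/-- The condition number `σ₁ / σ_k` of the best rank-`k` approximation of `A` (for `1 ≤ k`). -/
def condNumber {n d : ℕ} (A : Matrix (Fin n) (Fin d) ℝ) (k : ℕ) : ℝ :=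
  singularValue A 0 / singularValue A (k - 1)

/-! ### The uniformly dithered quantizer -/

/-- The resolution `Δ = 2R / (M - 1)`, with `M = 2 ^ B`, for dynamic range `R` and `B` bits. -/
def resolution (R : ℝ) (B : ℕ) : ℝ := 2 * R / (2 ^ B - 1)

/-- The quantization points `-R + j Δ`; those of the quantizer are `j = 0, …, 2 ^ B - 1`. -/
def level (R : ℝ) (B : ℕ) (j : ℤ) : ℝ := -R + j * resolution R B

/-- The index of the largest quantization point that is at most `x` (for `|x| ≤ R`). -/
def cell (R : ℝ) (B : ℕ) (x : ℝ) : ℤ := ⌊(x + R) / resolution R B⌋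

/-- The probability `r = (x - q_j) / Δ` of rounding `x ∈ [q_j, q_{j+1})` up to `q_{j+1}`. -/
def upProb (R : ℝ) (B : ℕ) (x : ℝ) : ℝ :=
  (x - level R B (cell R B x)) / resolution R B

theorem upProb_mem (R : ℝ) (B : ℕ) (x : ℝ) : upProb R B x ∈ Set.Icc (0 : ℝ) 1 := by
  by_cases h : resolution R B = 0
  · simp [upProb, h]
  · have e : upProb R B x = Int.fract ((x + R) / resolution R B) := by
      rw [upProb, level, cell, Int.fract]
      field_simp
      ring
    rw [e]
    exact ⟨Int.fract_nonneg _, (Int.fract_lt_one _).le⟩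

/-- The dither of the scalar quantizer at `x`: `true` (round up) with probability `upProb R B x`,
`false` (round down) otherwise. -/
def coin (R : ℝ) (B : ℕ) (x : ℝ) : PMF Bool :=
  PMF.ofFintype
    (fun b => ENNReal.ofReal (if b then upProb R B x else 1 - upProb R B x)) (by
      have h := upProb_mem R B x
      rw [Fintype.sum_bool, ← ENNReal.ofReal_add] <;> simp [h.1, h.2])

/-- The value of the scalar quantizer at `x` when the dither is `b`. -/
def rounded (R : ℝ) (B : ℕ) (x : ℝ) (b : Bool) : ℝ :=
  if b then level R B (cell R B x + 1) else level R B (cell R B x)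

/-- The joint law of finitely many independent random variables with laws `p i`. -/
def independent {ι : Type} {α : ι → Type} [Fintype ι] [DecidableEq ι] [∀ i, Fintype (α i)]
    (p : ∀ i, PMF (α i)) : PMF (∀ i, α i) :=
  PMF.ofFintype (fun f => ∏ i, p i (f i)) (by
    rw [← Fintype.prod_sum]
    refine Finset.prod_eq_one fun i _ => ?_
    rw [← tsum_fintype (L := .unconditional _)]
    exact (p i).tsum_coe)

/-- The law of the quantized matrix: each entry is quantized independently. -/
def quantize {m n : ℕ} (R : ℝ) (B : ℕ) (X : Matrix (Fin m) (Fin n) ℝ) :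
    PMF (Matrix (Fin m) (Fin n) ℝ) :=
  (independent fun p : Fin m × Fin n => coin R B (X p.1 p.2)).map
    fun b => Matrix.of fun i j => rounded R B (X i j) (b (i, j))

/-- A quantizer of dynamic range `R` is saturated by `X` if some entry is outside `[-R, R]`. -/
def Saturated {m n : ℕ} (R : ℝ) (X : Matrix (Fin m) (Fin n) ℝ) : Prop :=
  ∃ i j, R < |X i j|

/-! ### The algorithm -/

/-- `W` solves all the least-squares problems `min_Y ‖L Y - A‖`. -/
def IsLeastSquaresSolver {n d k : ℕ} (A : Matrix (Fin n) (Fin d) ℝ)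
    (W : Matrix (Fin n) (Fin k) ℝ → Matrix (Fin k) (Fin d) ℝ) : Prop :=
  ∀ (L : Matrix (Fin n) (Fin k) ℝ) (Y : Matrix (Fin k) (Fin d) ℝ), ‖L * W L - A‖ ≤ ‖L * Y - A‖

open Classical in
/-- The law of the output `(L, R)` of the algorithm for the matrix `A`, with left singular vectors
`U`, target rank `k`, dynamic ranges `RQ`, `RQ'`, bit budgets `B`, `B'`, and least-squares solver
`W`: quantize the scaled top-`k` left singular vectors to get `L`, then quantize `W L` with fresh
independent dithers to get `R`. If a quantizer is saturated, the zero factors are returned. -/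
def lplrSvd {n d k : ℕ} (A : Matrix (Fin n) (Fin d) ℝ) (U : Matrix (Fin n) (Fin n) ℝ)
    (hk : k ≤ d) (RQ RQ' : ℝ) (B B' : ℕ)
    (W : Matrix (Fin n) (Fin k) ℝ → Matrix (Fin k) (Fin d) ℝ) :
    PMF (Matrix (Fin n) (Fin k) ℝ × Matrix (Fin k) (Fin d) ℝ) :=
  if Saturated RQ (scaledLeftFactor A U hk) then PMF.pure (0, 0)
  else (quantize RQ B (scaledLeftFactor A U hk)).bind fun L =>
    if Saturated RQ' (W L) then PMF.pure (0, 0)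
    else (quantize RQ' B' (W L)).map fun R => (L, R)

/-- The expectation of a nonnegative function under a discrete law. -/
def expectation {α : Type} (p : PMF α) (f : α → ℝ≥0∞) : ℝ≥0∞ := ∑' a, p a * f a

end

end LPLR

/-!
The algorithm outputs `L R` with `L = X + E` and `R = W + F`, where `X` is the scaled factor of the
top `k` left singular vectors, `W` the least-squares solution for `L`, and `E`, `F` the quantization
errors, which are independent and centred entrywise. Given `L`, the mean of `‖L R - A‖²` is
`‖L W - A‖²` plus a variance term, at most `‖L‖² d Δ'² / 4`, whose mean is at most `ε / 2` by the
choice of `B'`. By minimality `‖L W - A‖` is at most `‖L Vₖᵀ - A‖`, and the mean of its square exceeds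
`‖X Vₖᵀ - A‖²` only by the variance of `E`, at most `ε / 4`. Finally `X Vₖᵀ` is a best rank-`k`
approximation by the Eckart–Young inequality (`IsSVD.frobenius_truncation_sq_le`).

It remains to see that saturation of the second quantizer is unlikely. If the spectral norm of `E` is
at most `σ_k / 2`, then `‖L w‖ ≥ σ_k / 2 * ‖w‖`, while the normal equations give
`‖L W e‖ ≤ ‖A e‖ ≤ σ₁` for each standard basis vector `e`, so the entries of `W` are at most
`2 σ₁ / σ_k` (`IsSVD.not_saturated_leastSquares`). The spectral norm of `E` is controlled by a
sub-Gaussian tail bound (`productMean_opNorm_tail`). It is obtained without nets, by averaging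
`exp (l ⟪u, E v⟫)` over a product of balls: the pairs `(u, v)` near the top singular vectors occupy a
fraction `5 ^ -(n + k)` of the volume, which bounds the average below in terms of the spectral norm
(`exp_opNorm_le_average`), and the mean of the integrand is bounded pointwise by independence
(`productMean_exp_opNorm_le`).

All probabilities are computed as finite sums over the dithers (`productMean`), to which the
expectations under the quantizer laws reduce (`expectation_quantize`).
-/

namespace LPLR

/-! ### Averages over independent dithers -/

/-- The mass of `b` under the Bernoulli law with success probability `r`. -/
noncomputable def bernoulliWeight (r : ℝ) (b : Bool) : ℝ := if b then r else 1 - r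

/-- The rounding error of a dithered quantizer of unit resolution when the probability of rounding
up is `r`: it is `1 - r` when rounding up and `-r` when rounding down. -/
noncomputable def ditherError (r : ℝ) (b : Bool) : ℝ := if b then 1 - r else -r

/-- The expectation of `f` under the product of the Bernoulli laws with success probabilities
`r i`, as a finite sum. -/
noncomputable def productMean {ι : Type} [Fintype ι] [DecidableEq ι] (r : ι → ℝ)
    (f : (ι → Bool) → ℝ) : ℝ :=
  ∑ b, (∏ i, bernoulliWeight (r i) (b i)) * f b

theorem bernoulliWeight_nonneg {r : ℝ} (h : r ∈ Set.Icc (0 : ℝ) 1) (b : Bool) :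
    0 ≤ bernoulliWeight r b := by
  cases b <;> simp [bernoulliWeight, h.1, h.2]

theorem prod_bernoulliWeight_nonneg {ι : Type} [Fintype ι] {r : ι → ℝ}
    (h : ∀ i, r i ∈ Set.Icc (0 : ℝ) 1) (b : ι → Bool) :
    0 ≤ ∏ i, bernoulliWeight (r i) (b i) :=
  Finset.prod_nonneg fun i _ => bernoulliWeight_nonneg (h i) _

section productMean

variable {ι : Type} [Fintype ι] [DecidableEq ι] {r : ι → ℝ}

theorem productMean_prod (r : ι → ℝ) (f : ι → Bool → ℝ) :
    productMean r (fun b => ∏ i, f i (b i)) = ∏ i, (r i * f i true + (1 - r i) * f i false) := by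
  simp only [productMean, ← Finset.prod_mul_distrib]
  rw [← Fintype.prod_sum (fun i c => bernoulliWeight (r i) c * f i c)]
  simp [bernoulliWeight]

theorem productMean_one (r : ι → ℝ) : productMean r (fun _ => 1) = 1 := by
  simpa using productMean_prod r (fun _ _ => 1)

theorem productMean_add (r : ι → ℝ) (f g : (ι → Bool) → ℝ) :
    productMean r (fun b => f b + g b) = productMean r f + productMean r g := by
  simp [productMean, mul_add, Finset.sum_add_distrib]

theorem productMean_const_mul (r : ι → ℝ) (c : ℝ) (f : (ι → Bool) → ℝ) :
    productMean r (fun b => c * f b) = c * productMean r f := by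
  simp only [productMean, Finset.mul_sum]
  exact Finset.sum_congr rfl fun b _ => by ring

theorem productMean_const (r : ι → ℝ) (c : ℝ) : productMean r (fun _ => c) = c := by
  simpa [productMean_one] using productMean_const_mul r c (fun _ => 1)

theorem productMean_sum {κ : Type*} (s : Finset κ) (r : ι → ℝ) (f : κ → (ι → Bool) → ℝ) :
    productMean r (fun b => ∑ j ∈ s, f j b) = ∑ j ∈ s, productMean r (f j) := by
  simp only [productMean, Finset.mul_sum]
  exact Finset.sum_comm

theorem productMean_mono (h : ∀ i, r i ∈ Set.Icc (0 : ℝ) 1) {f g : (ι → Bool) → ℝ}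
    (hfg : ∀ b, f b ≤ g b) : productMean r f ≤ productMean r g :=
  Finset.sum_le_sum fun b _ =>
    mul_le_mul_of_nonneg_left (hfg b) (prod_bernoulliWeight_nonneg h b)

theorem productMean_ditherError (r : ι → ℝ) (i : ι) :
    productMean r (fun b => ditherError (r i) (b i)) = 0 := by
  have h := productMean_prod r (fun j c => if j = i then ditherError (r j) c else 1)
  have e : ∀ b : ι → Bool, (∏ j, if j = i then ditherError (r j) (b j) else 1)
      = ditherError (r i) (b i) := fun b => by
    rw [Finset.prod_ite_eq' Finset.univ i (fun j => ditherError (r j) (b j))]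
    simp
  simp only [e] at h
  rw [h]
  refine Finset.prod_eq_zero (Finset.mem_univ i) ?_
  simp only [ditherError, if_true]
  simp
  ring

theorem productMean_ditherError_mul (r : ι → ℝ) {i j : ι} (hij : i ≠ j) :
    productMean r (fun b => ditherError (r i) (b i) * ditherError (r j) (b j)) = 0 := by
  have h := productMean_prod r
    (fun l c => (if l = i then ditherError (r l) c else 1) *
      if l = j then ditherError (r l) c else 1)
  have e : ∀ b : ι → Bool, (∏ l, (if l = i then ditherError (r l) (b l) else 1) *
        if l = j then ditherError (r l) (b l) else 1)
      = ditherError (r i) (b i) * ditherError (r j) (b j) := fun b => by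
    rw [Finset.prod_mul_distrib,
      Finset.prod_ite_eq' Finset.univ i (fun l => ditherError (r l) (b l)),
      Finset.prod_ite_eq' Finset.univ j (fun l => ditherError (r l) (b l))]
    simp
  simp only [e] at h
  rw [h]
  refine Finset.prod_eq_zero (Finset.mem_univ i) ?_
  simp only [ditherError, if_true, if_neg hij]
  simp
  ring

/-- The variance of a Bernoulli variable is at most `1 / 4`. -/
theorem productMean_ditherError_sq_le (r : ι → ℝ) (i : ι) :
    productMean r (fun b => ditherError (r i) (b i) ^ 2) ≤ 1 / 4 := by
  have h := productMean_prod r (fun j c => if j = i then ditherError (r j) c ^ 2 else 1)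
  have e : ∀ b : ι → Bool, (∏ j, if j = i then ditherError (r j) (b j) ^ 2 else 1)
      = ditherError (r i) (b i) ^ 2 := fun b => by
    rw [Finset.prod_ite_eq' Finset.univ i (fun j => ditherError (r j) (b j) ^ 2)]
    simp
  simp only [e] at h
  rw [h, Finset.prod_eq_single i]
  · simp [ditherError]
    nlinarith [sq_nonneg (r i - 1 / 2)]
  · intro j _ hj
    simp [hj]
  · simp

/-- The cross terms vanish because the dither errors are independent and centred, so the second
moment of an affine function of them is its squared mean plus its variance. -/
theorem productMean_affine_sq_le (r : ι → ℝ) (g : ℝ) (c : ι → ℝ) :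
    productMean r (fun b => (g + ∑ i, c i * ditherError (r i) (b i)) ^ 2)
      ≤ g ^ 2 + (∑ i, c i ^ 2) / 4 := by
  have e : ∀ b : ι → Bool, (g + ∑ i, c i * ditherError (r i) (b i)) ^ 2
      = g ^ 2 + ((∑ i, (2 * g * c i) * ditherError (r i) (b i)) +
        ∑ i, ∑ j, (c i * c j) * (ditherError (r i) (b i) * ditherError (r j) (b j))) := fun b => by
    have h1 : ∑ i, (2 * g * c i) * ditherError (r i) (b i)
        = 2 * g * ∑ i, c i * ditherError (r i) (b i) := by
      rw [Finset.mul_sum]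
      exact Finset.sum_congr rfl fun i _ => by ring
    have h2 : ∑ i, ∑ j, (c i * c j) * (ditherError (r i) (b i) * ditherError (r j) (b j))
        = (∑ i, c i * ditherError (r i) (b i)) * ∑ i, c i * ditherError (r i) (b i) := by
      rw [Finset.sum_mul_sum]
      exact Finset.sum_congr rfl fun i _ => Finset.sum_congr rfl fun j _ => by ring
    rw [h1, h2]
    ring
  simp only [e, productMean_add, productMean_const, productMean_sum, productMean_const_mul,
    productMean_ditherError, mul_zero, Finset.sum_const_zero, zero_add]
  gcongr
  rw [Finset.sum_div]
  refine Finset.sum_le_sum fun i _ => ?_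
  rw [Finset.sum_eq_single i]
  · have := productMean_ditherError_sq_le r i
    simp only [← sq] at this ⊢
    nlinarith [sq_nonneg (c i)]
  · intro j _ hj
    rw [productMean_ditherError_mul r hj.symm, mul_zero]
  · simp

theorem exp_le_add_exp_sq (x : ℝ) : Real.exp x ≤ x + Real.exp (x ^ 2) := by
  have hsq := Real.add_one_le_exp (x ^ 2)
  rcases le_or_gt |x| 1 with h | h
  · have := (abs_le.1 (Real.abs_exp_sub_one_sub_id_le h)).2
    linarith
  · rcases lt_abs.1 h with h | h
    · have : Real.exp x ≤ Real.exp (x ^ 2) := Real.exp_le_exp.2 (by nlinarith)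
      linarith
    · have : Real.exp x ≤ 1 := Real.exp_le_one_iff.2 (by linarith)
      nlinarith

/-- The dither error is centred and bounded by `1`, hence sub-Gaussian. -/
theorem bernoulli_exp_ditherError_le {r : ℝ} (h : r ∈ Set.Icc (0 : ℝ) 1) (c : ℝ) :
    r * Real.exp (c * ditherError r true) + (1 - r) * Real.exp (c * ditherError r false)
      ≤ Real.exp (c ^ 2) := by
  have key : ∀ x : ℝ, |x| ≤ 1 → Real.exp (c * x) ≤ c * x + Real.exp (c ^ 2) := fun x hx => by
    refine (exp_le_add_exp_sq _).trans
      (add_le_add le_rfl (Real.exp_le_exp.2 ?_))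
    rw [mul_pow]
    have : x ^ 2 ≤ 1 := (sq_le_one_iff_abs_le_one x).2 hx
    nlinarith [sq_nonneg c]
  have h1 := key (1 - r) (abs_le.2 ⟨by linarith [h.2], by linarith [h.1]⟩)
  have h2 := key (-r) (abs_le.2 ⟨by linarith [h.2], by linarith [h.1]⟩)
  have h3 := mul_le_mul_of_nonneg_left h1 h.1
  have h4 := mul_le_mul_of_nonneg_left h2 (sub_nonneg.2 h.2)
  simp only [ditherError, if_true]
  simp only [Bool.false_eq_true, if_false]
  linarith

theorem productMean_exp_le (h : ∀ i, r i ∈ Set.Icc (0 : ℝ) 1) (c : ι → ℝ) :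
    productMean r (fun b => Real.exp (∑ i, c i * ditherError (r i) (b i)))
      ≤ Real.exp (∑ i, c i ^ 2) := by
  simp only [Real.exp_sum]
  rw [productMean_prod r (fun i x => Real.exp (c i * ditherError (r i) x))]
  exact Finset.prod_le_prod
    (fun i _ => add_nonneg (mul_nonneg (h i).1 (Real.exp_nonneg _))
      (mul_nonneg (sub_nonneg.2 (h i).2) (Real.exp_nonneg _)))
    fun i _ => bernoulli_exp_ditherError_le (h i) (c i)

end productMean

/-! ### Expectations under the quantizer laws -/

theorem expectation_pure {α : Type} (a : α) (f : α → ℝ≥0∞) : expectation (PMF.pure a) f = f a := by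
  classical
  rw [expectation, tsum_eq_single a]
  · simp
  · intro b hb
    simp [PMF.pure_apply, hb]

theorem expectation_bind {α β : Type} (p : PMF α) (q : α → PMF β) (f : β → ℝ≥0∞) :
    expectation (p.bind q) f = expectation p fun a => expectation (q a) f := by
  simp only [expectation, PMF.bind_apply, ← ENNReal.tsum_mul_left, ← ENNReal.tsum_mul_right]
  rw [ENNReal.tsum_comm]
  simp only [mul_assoc]

theorem expectation_map {α β : Type} (p : PMF α) (g : α → β) (f : β → ℝ≥0∞) :
    expectation (p.map g) f = expectation p (f ∘ g) := by
  rw [← PMF.bind_pure_comp, expectation_bind]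
  simp [expectation_pure, Function.comp_def]

theorem expectation_mono {α : Type} (p : PMF α) {f g : α → ℝ≥0∞} (h : ∀ a, f a ≤ g a) :
    expectation p f ≤ expectation p g :=
  ENNReal.tsum_le_tsum fun a => mul_le_mul_right (h a) _

/-- The matrix of dither errors of unit resolution, for dithers `b` and probabilities `r` of
rounding up. -/
noncomputable def ditherMatrix {m n : ℕ} (r : Fin m × Fin n → ℝ) (b : Fin m × Fin n → Bool) :
    Matrix (Fin m) (Fin n) ℝ :=
  Matrix.of fun i j => ditherError (r (i, j)) (b (i, j))

theorem rounded_eq {R : ℝ} {B : ℕ} (h : resolution R B ≠ 0) (x : ℝ) (b : Bool) :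
    rounded R B x b = x + resolution R B * ditherError (upProb R B x) b := by
  have e : resolution R B * upProb R B x = x - level R B (cell R B x) := by
    rw [upProb]
    field_simp
  cases b
  · simp only [rounded, ditherError, Bool.false_eq_true, if_false]
    linarith
  · simp only [rounded, ditherError, if_true]
    rw [mul_sub, e]
    simp only [level]
    push_cast
    ring

theorem expectation_quantize {m n : ℕ} {R : ℝ} {B : ℕ} (h : resolution R B ≠ 0)
    (X : Matrix (Fin m) (Fin n) ℝ) {g : Matrix (Fin m) (Fin n) ℝ → ℝ} (hg : ∀ L, 0 ≤ g L) :
    expectation (quantize R B X) (fun L => ENNReal.ofReal (g L)) =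
      ENNReal.ofReal (productMean (fun p : Fin m × Fin n => upProb R B (X p.1 p.2))
        fun b => g (X + resolution R B • ditherMatrix (fun p => upProb R B (X p.1 p.2)) b)) := by
  rw [quantize, expectation_map, expectation, tsum_fintype, productMean,
    ENNReal.ofReal_sum_of_nonneg]
  · refine Finset.sum_congr rfl fun b _ => ?_
    rw [ENNReal.ofReal_mul (prod_bernoulliWeight_nonneg (fun _ => upProb_mem _ _ _) b),
      ENNReal.ofReal_prod_of_nonneg fun i _ => bernoulliWeight_nonneg (upProb_mem _ _ _) _]
    have e : (Matrix.of fun i j => rounded R B (X i j) (b (i, j)))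
        = X + resolution R B • ditherMatrix (fun p => upProb R B (X p.1 p.2)) b := by
      ext i j
      simp [rounded_eq h, ditherMatrix]
    simp only [Function.comp_apply, e]
    rfl
  · exact fun b _ => mul_nonneg (prod_bernoulliWeight_nonneg (fun _ => upProb_mem _ _ _) b) (hg _)

/-! ### The operator norm of a random error matrix -/

open MeasureTheory Metric in
/-- In place of a net: `⟪u, T v⟫` is at least `7 / 16 * ‖T‖` for all `u` and `v` within distance
`1 / 4` of a pair of top singular vectors, and the pairs of such points make up a fraction
`5 ^ -(n + k)` of the volume of a product of balls of radius `5 / 4`. -/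
theorem exp_opNorm_le_average {n k : ℕ}
    (T : EuclideanSpace ℝ (Fin k) →L[ℝ] EuclideanSpace ℝ (Fin n))
    {l : ℝ} (hl : 0 ≤ l) :
    Real.exp (7 / 16 * l * ‖T‖) ≤ 5 ^ (n + k) *
      ⨍ p in closedBall (0 : EuclideanSpace ℝ (Fin n)) (5 / 4) ×ˢ
          closedBall (0 : EuclideanSpace ℝ (Fin k)) (5 / 4),
        Real.exp (l * inner ℝ p.1 (T p.2)) := by
  obtain ⟨v₀, hv₀, hmax⟩ := (isCompact_closedBall (0 : EuclideanSpace ℝ (Fin k)) 1).exists_isMaxOn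
    ⟨0, by simp⟩ (f := fun v => ‖T v‖) (by fun_prop)
  have hv₀' : ‖v₀‖ ≤ 1 := by simpa using hv₀
  have hTv : ‖T v₀‖ = ‖T‖ := by
    rw [← T.sSup_unitClosedBall_eq_norm]
    have hg : IsGreatest ((fun v => ‖T v‖) '' closedBall 0 1) ‖T v₀‖ := by
      refine ⟨⟨v₀, hv₀, rfl⟩, ?_⟩
      rintro _ ⟨v, hv, rfl⟩
      exact hmax hv
    exact hg.csSup_eq.symm
  obtain ⟨u₀, hu₀, huT⟩ : ∃ u₀ : EuclideanSpace ℝ (Fin n), ‖u₀‖ ≤ 1 ∧ inner ℝ u₀ (T v₀) = ‖T‖ := by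
    refine ⟨‖T v₀‖⁻¹ • T v₀, ?_, ?_⟩
    · rw [norm_smul, norm_inv, norm_norm]
      exact inv_mul_le_one
    · rw [real_inner_smul_left, real_inner_self_eq_norm_sq, ← hTv]
      rcases eq_or_ne ‖T v₀‖ 0 with h | h
      · simp [h]
      · field_simp
  have hlow : ∀ p ∈ closedBall u₀ (1 / 4) ×ˢ closedBall v₀ (1 / 4),
      7 / 16 * l * ‖T‖ ≤ l * inner ℝ p.1 (T p.2) := by
    rintro ⟨u, v⟩ ⟨hu, hv⟩
    simp only [mem_closedBall, dist_eq_norm] at hu hv ⊢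
    have e : inner ℝ u (T v) = inner ℝ u₀ (T v₀) + inner ℝ (u - u₀) (T v₀)
        + inner ℝ u (T (v - v₀)) := by
      simp only [map_sub, inner_sub_left, inner_sub_right]
      ring
    have hu' : ‖u‖ ≤ 5 / 4 := by
      have := norm_le_norm_add_norm_sub' u u₀
      linarith
    have h1 : -(1 / 4 * ‖T‖) ≤ inner ℝ (u - u₀) (T v₀) := by
      have := (abs_le.1 (abs_real_inner_le_norm (u - u₀) (T v₀))).1
      rw [hTv] at this
      have := mul_le_mul_of_nonneg_right hu (norm_nonneg T)
      linarith
    have h2 : -(5 / 16 * ‖T‖) ≤ inner ℝ u (T (v - v₀)) := by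
      have h3 := (abs_le.1 (abs_real_inner_le_norm u (T (v - v₀)))).1
      have h4 : ‖T (v - v₀)‖ ≤ ‖T‖ * (1 / 4) :=
        (T.le_opNorm _).trans (mul_le_mul_of_nonneg_left hv (norm_nonneg T))
      have h5 : ‖u‖ * ‖T (v - v₀)‖ ≤ 5 / 4 * (‖T‖ * (1 / 4)) :=
        mul_le_mul hu' h4 (norm_nonneg _) (by norm_num)
      linarith
    have : 7 / 16 * ‖T‖ ≤ inner ℝ u (T v) := by rw [e, huT]; linarith
    nlinarith
  set S := closedBall (0 : EuclideanSpace ℝ (Fin n)) (5 / 4) ×ˢ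
          closedBall (0 : EuclideanSpace ℝ (Fin k)) (5 / 4) with hS
  set S₀ := closedBall u₀ (1 / 4) ×ˢ closedBall v₀ (1 / 4) with hS₀
  have hScomp : IsCompact S := (isCompact_closedBall _ _).prod (isCompact_closedBall _ _)
  have hS₀comp : IsCompact S₀ := (isCompact_closedBall _ _).prod (isCompact_closedBall _ _)
  have hsub : S₀ ⊆ S := by
    refine Set.prod_mono (fun u hu => ?_) (fun v hv => ?_)
    · simp only [mem_closedBall, dist_eq_norm, sub_zero] at hu ⊢
      have := norm_le_norm_add_norm_sub' u u₀
      linarith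
    · simp only [mem_closedBall, dist_eq_norm, sub_zero] at hv ⊢
      have := norm_le_norm_add_norm_sub' v v₀
      linarith
  have hint : IntegrableOn (fun p : EuclideanSpace ℝ (Fin n) × EuclideanSpace ℝ (Fin k) =>
      Real.exp (l * inner ℝ p.1 (T p.2))) S :=
    ContinuousOn.integrableOn_compact hScomp (by fun_prop)
  have hvol : volume.real S = 5 ^ (n + k) * volume.real S₀ := by
    simp only [hS, hS₀, measureReal_def, Measure.volume_eq_prod, Measure.prod_prod]
    rw [Measure.addHaar_closedBall _ _ (by norm_num), Measure.addHaar_closedBall _ _ (by norm_num),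
      Measure.addHaar_closedBall _ _ (by norm_num), Measure.addHaar_closedBall _ _ (by norm_num)]
    simp only [ENNReal.toReal_mul, finrank_euclideanSpace, Fintype.card_fin]
    rw [ENNReal.toReal_ofReal (by positivity), ENNReal.toReal_ofReal (by positivity),
      ENNReal.toReal_ofReal (by positivity), ENNReal.toReal_ofReal (by positivity)]
    rw [show (5 / 4 : ℝ) = 5 * (1 / 4) by norm_num, mul_pow, mul_pow, pow_add]
    ring
  have hpos : 0 < volume.real S₀ := by
    refine ENNReal.toReal_pos ?_ hS₀comp.measure_lt_top.ne
    simp only [hS₀, Measure.volume_eq_prod, Measure.prod_prod]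
    exact mul_ne_zero (measure_closedBall_pos _ _ (by norm_num)).ne'
      (measure_closedBall_pos _ _ (by norm_num)).ne'
  have hle : Real.exp (7 / 16 * l * ‖T‖) * volume.real S₀
      ≤ ∫ p in S, Real.exp (l * inner ℝ p.1 (T p.2)) := by
    calc _ = ∫ _ in S₀, Real.exp (7 / 16 * l * ‖T‖) := by simp [mul_comm]
      _ ≤ ∫ p in S₀, Real.exp (l * inner ℝ p.1 (T p.2)) :=
        setIntegral_mono_on (integrableOn_const hS₀comp.measure_lt_top.ne) (hint.mono_set hsub)
          hS₀comp.measurableSet fun p hp => Real.exp_le_exp.2 (hlow p hp)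
      _ ≤ _ := setIntegral_mono_set hint (ae_of_all _ fun _ => Real.exp_nonneg _)
        (LE.le.eventuallyLE hsub)
  rw [setAverage_eq, hvol, smul_eq_mul, mul_inv, ← mul_assoc, ← mul_assoc,
    mul_inv_cancel₀ (by positivity), one_mul, inv_mul_eq_div, le_div_iff₀ hpos]
  exact hle

/-- The operator from `ℝᵏ` to `ℝⁿ` given by a matrix; its norm is the spectral norm. -/
noncomputable def euclideanOp {n k : ℕ} (M : Matrix (Fin n) (Fin k) ℝ) :
    EuclideanSpace ℝ (Fin k) →L[ℝ] EuclideanSpace ℝ (Fin n) :=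
  LinearMap.toContinuousLinearMap (Matrix.toEuclideanLin M)

theorem euclideanOp_apply {n k : ℕ} (M : Matrix (Fin n) (Fin k) ℝ) (v : EuclideanSpace ℝ (Fin k))
    (i : Fin n) : euclideanOp M v i = ∑ j, M i j * v j := rfl

section OpNorm

variable {n k : ℕ} {r : Fin n × Fin k → ℝ}

open MeasureTheory Metric in
/-- The exponential moment of the spectral norm of a matrix of independent dither errors: after
exchanging the average over the ball with the mean, each integrand is the moment generating function
of a sum of independent centred bounded variables. -/
theorem productMean_exp_opNorm_le (h : ∀ p, r p ∈ Set.Icc (0 : ℝ) 1) {l : ℝ} (hl : 0 ≤ l) :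
    productMean r (fun b => Real.exp (7 / 16 * l *
        ‖euclideanOp (ditherMatrix r b)‖))
      ≤ 5 ^ (n + k) * Real.exp (625 / 256 * l ^ 2) := by
  refine (productMean_mono h fun b => exp_opNorm_le_average _ hl).trans ?_
  rw [productMean_const_mul]
  refine mul_le_mul_of_nonneg_left ?_ (by positivity)
  set S := closedBall (0 : EuclideanSpace ℝ (Fin n)) (5 / 4) ×ˢ
          closedBall (0 : EuclideanSpace ℝ (Fin k)) (5 / 4) with hS
  have hScomp : IsCompact S := (isCompact_closedBall _ _).prod (isCompact_closedBall _ _)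
  have hS0 : volume S ≠ 0 := by
    simp only [hS, Measure.volume_eq_prod, Measure.prod_prod]
    exact mul_ne_zero (measure_closedBall_pos _ _ (by norm_num)).ne'
      (measure_closedBall_pos _ _ (by norm_num)).ne'
  have hint : ∀ b : Fin n × Fin k → Bool,
      IntegrableOn (fun p : EuclideanSpace ℝ (Fin n) × EuclideanSpace ℝ (Fin k) =>
        Real.exp (l * inner ℝ p.1
          (euclideanOp (ditherMatrix r b) p.2))) S := fun b =>
    ContinuousOn.integrableOn_compact hScomp (by fun_prop)
  have hswap : productMean r (fun b => ⨍ p in S, Real.exp (l * inner ℝ p.1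
          (euclideanOp (ditherMatrix r b) p.2)))
      = ⨍ p in S, productMean r (fun b => Real.exp (l * inner ℝ p.1
          (euclideanOp (ditherMatrix r b) p.2))) := by
    simp only [setAverage_eq, smul_eq_mul, productMean_const_mul]
    congr 1
    simp only [productMean]
    rw [integral_finsetSum _ fun b _ => (hint b).const_mul _]
    exact Finset.sum_congr rfl fun b _ => (integral_const_mul _ _).symm
  rw [hswap]
  have hpt : ∀ p ∈ S, productMean r (fun b => Real.exp (l * inner ℝ p.1
        (euclideanOp (ditherMatrix r b) p.2)))
      ≤ Real.exp (625 / 256 * l ^ 2) := by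
    rintro ⟨u, v⟩ ⟨hu, hv⟩
    have hu : ‖u‖ ≤ 5 / 4 := by simpa using hu
    have hv : ‖v‖ ≤ 5 / 4 := by simpa using hv
    have e : ∀ b : Fin n × Fin k → Bool, l * inner ℝ u
          (euclideanOp (ditherMatrix r b) v)
        = ∑ q : Fin n × Fin k, (l * u q.1 * v q.2) * ditherError (r q) (b q) := fun b => by
      rw [PiLp.inner_apply, Fintype.sum_prod_type, Finset.mul_sum]
      refine Finset.sum_congr rfl fun i _ => ?_
      rw [euclideanOp_apply]
      simp only [RCLike.inner_apply, conj_trivial, ditherMatrix, Matrix.of_apply,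
        Finset.sum_mul, Finset.mul_sum]
      exact Finset.sum_congr rfl fun j _ => by ring
    simp only [e]
    refine (productMean_exp_le h _).trans (Real.exp_le_exp.2 ?_)
    have e2 : ∑ q : Fin n × Fin k, (l * u q.1 * v q.2) ^ 2 = l ^ 2 * (‖u‖ ^ 2 * ‖v‖ ^ 2) := by
      rw [EuclideanSpace.real_norm_sq_eq, EuclideanSpace.real_norm_sq_eq, Finset.sum_mul_sum,
        Fintype.sum_prod_type, Finset.mul_sum]
      refine Finset.sum_congr rfl fun i _ => ?_
      rw [Finset.mul_sum]
      exact Finset.sum_congr rfl fun j _ => by ring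
    rw [e2]
    have h1 : ‖u‖ ^ 2 ≤ 25 / 16 := by nlinarith [norm_nonneg u]
    have h2 : ‖v‖ ^ 2 ≤ 25 / 16 := by nlinarith [norm_nonneg v]
    have h3 : ‖u‖ ^ 2 * ‖v‖ ^ 2 ≤ 25 / 16 * (25 / 16) :=
      mul_le_mul h1 h2 (by positivity) (by norm_num)
    nlinarith [sq_nonneg l]
  have hintm : IntegrableOn (fun p : EuclideanSpace ℝ (Fin n) × EuclideanSpace ℝ (Fin k) =>
      productMean r (fun b => Real.exp (l * inner ℝ p.1
        (euclideanOp (ditherMatrix r b) p.2)))) S := by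
    simp only [productMean]
    exact integrable_finsetSum _ fun b _ => (hint b).const_mul _
  have hSpos : 0 < volume.real S := ENNReal.toReal_pos hS0 hScomp.measure_lt_top.ne
  rw [setAverage_eq, smul_eq_mul, inv_mul_le_iff₀ hSpos]
  calc _ ≤ ∫ _ in S, Real.exp (625 / 256 * l ^ 2) :=
        setIntegral_mono_on hintm (integrableOn_const hScomp.measure_lt_top.ne)
          hScomp.measurableSet hpt
    _ = _ := by simp

/-- The spectral norm of a matrix of independent dither errors exceeds a multiple of
`√n + √k + t` with probability at most `exp (-t ^ 2)`. -/
theorem productMean_opNorm_tail (h : ∀ p, r p ∈ Set.Icc (0 : ℝ) 1) {t : ℝ} (ht : 0 ≤ t) :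
    productMean r (fun b => if 16 * (Real.sqrt n + Real.sqrt k + t) <
        ‖euclideanOp (ditherMatrix r b)‖ then 1 else 0)
      ≤ Real.exp (-t ^ 2) := by
  set s := Real.sqrt n + Real.sqrt k + t with hs
  have hs0 : 0 ≤ s := by positivity
  -- Markov's inequality for the exponential moment of order `s`
  have hM : ∀ b : Fin n × Fin k → Bool, (if 16 * s <
        ‖euclideanOp (ditherMatrix r b)‖ then (1 : ℝ) else 0)
      ≤ Real.exp (-(16 * s ^ 2)) * Real.exp (7 / 16 * (16 / 7 * s) *
        ‖euclideanOp (ditherMatrix r b)‖) := fun b => by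
    split_ifs with hb
    · rw [← Real.exp_add]
      exact Real.one_le_exp (by nlinarith)
    · positivity
  refine (productMean_mono h hM).trans ?_
  rw [productMean_const_mul]
  refine (mul_le_mul_of_nonneg_left (productMean_exp_opNorm_le h (by positivity))
    (Real.exp_nonneg _)).trans ?_
  have h5 : (5 : ℝ) ^ (n + k) ≤ Real.exp (2 * (n + k)) := by
    have h2 : (5 : ℝ) ≤ Real.exp 2 := by
      have := Real.exp_one_gt_d9
      have e : Real.exp 2 = Real.exp 1 * Real.exp 1 := by rw [← Real.exp_add]; norm_num
      rw [e]
      nlinarith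
    calc (5 : ℝ) ^ (n + k) ≤ Real.exp 2 ^ (n + k) := pow_le_pow_left₀ (by norm_num) h2 _
      _ = _ := by rw [← Real.exp_nat_mul]; push_cast; ring_nf
  have hn := Real.sq_sqrt (Nat.cast_nonneg (α := ℝ) n)
  have hk := Real.sq_sqrt (Nat.cast_nonneg (α := ℝ) k)
  have hs2 : n + k + t ^ 2 ≤ s ^ 2 := by
    have := mul_nonneg (Real.sqrt_nonneg n) (Real.sqrt_nonneg k)
    have := mul_nonneg (Real.sqrt_nonneg n) ht
    have := mul_nonneg (Real.sqrt_nonneg k) ht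
    nlinarith
  calc _ ≤ Real.exp (-(16 * s ^ 2)) *
        (Real.exp (2 * (n + k)) * Real.exp (625 / 256 * (16 / 7 * s) ^ 2)) := by gcongr
    _ ≤ _ := by
      rw [← Real.exp_add, ← Real.exp_add, Real.exp_le_exp]
      nlinarith [sq_nonneg t, sq_nonneg s]

end OpNorm

/-! ### Frobenius norms -/

section Frobenius

variable {m n d k : ℕ}

theorem frobenius_sq (M : Matrix (Fin m) (Fin n) ℝ) : ‖M‖ ^ 2 = ∑ i, ∑ j, M i j ^ 2 := by
  rw [Matrix.frobenius_norm_def, ← Real.sqrt_eq_rpow, Real.sq_sqrt (by positivity)]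
  simp

theorem frobenius_sq_eq_trace (M : Matrix (Fin m) (Fin n) ℝ) :
    ‖M‖ ^ 2 = (M.transpose * M).trace := by
  rw [frobenius_sq, Finset.sum_comm]
  simp [Matrix.trace, Matrix.mul_apply, sq]

theorem frobenius_sub_sq (M N : Matrix (Fin m) (Fin n) ℝ) :
    ‖M - N‖ ^ 2 = ‖M‖ ^ 2 - 2 * (M.transpose * N).trace + ‖N‖ ^ 2 := by
  have h : (N.transpose * M).trace = (M.transpose * N).trace := by
    rw [← Matrix.trace_transpose, Matrix.transpose_mul, Matrix.transpose_transpose]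
  simp only [frobenius_sq_eq_trace, Matrix.transpose_sub, Matrix.sub_mul, Matrix.mul_sub,
    Matrix.trace_sub, h]
  ring

theorem frobenius_transpose (M : Matrix (Fin m) (Fin n) ℝ) : ‖M.transpose‖ = ‖M‖ :=
  Matrix.frobenius_norm_transpose M

theorem frobenius_isometry_mul {Q : Matrix (Fin m) (Fin n) ℝ} (hQ : Q.transpose * Q = 1)
    (M : Matrix (Fin n) (Fin d) ℝ) : ‖Q * M‖ = ‖M‖ := by
  have h : ‖Q * M‖ ^ 2 = ‖M‖ ^ 2 := by
    rw [frobenius_sq_eq_trace, frobenius_sq_eq_trace, Matrix.transpose_mul, Matrix.mul_assoc,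
      ← Matrix.mul_assoc Q.transpose, hQ, Matrix.one_mul]
  exact (sq_eq_sq₀ (norm_nonneg _) (norm_nonneg _)).1 h

theorem frobenius_mul_isometry_transpose {Q : Matrix (Fin m) (Fin n) ℝ}
    (hQ : Q.transpose * Q = 1) (M : Matrix (Fin d) (Fin n) ℝ) : ‖M * Q.transpose‖ = ‖M‖ := by
  rw [← frobenius_transpose, Matrix.transpose_mul, Matrix.transpose_transpose,
    frobenius_isometry_mul hQ, frobenius_transpose]

/-- Completing the square: the distance from `A` to the matrices with columns in the span of the
orthonormal columns of `Q`. -/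
theorem frobenius_isometry_mul_sub_sq {Q : Matrix (Fin m) (Fin n) ℝ} (hQ : Q.transpose * Q = 1)
    (Y : Matrix (Fin n) (Fin d) ℝ) (A : Matrix (Fin m) (Fin d) ℝ) :
    ‖Q * Y - A‖ ^ 2 = ‖A‖ ^ 2 - ‖Q.transpose * A‖ ^ 2 + ‖Y - Q.transpose * A‖ ^ 2 := by
  rw [frobenius_sub_sq, frobenius_sub_sq, frobenius_isometry_mul hQ, Matrix.transpose_mul,
    Matrix.mul_assoc]
  ring

/-- Bessel's inequality. -/
theorem frobenius_isometry_transpose_mul_sq_le {Q : Matrix (Fin m) (Fin n) ℝ}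
    (hQ : Q.transpose * Q = 1) (A : Matrix (Fin m) (Fin d) ℝ) :
    ‖Q.transpose * A‖ ^ 2 ≤ ‖A‖ ^ 2 := by
  have := frobenius_isometry_mul_sub_sq hQ (Q.transpose * A) A
  simp only [sub_self, norm_zero] at this
  nlinarith [sq_nonneg ‖Q * (Q.transpose * A) - A‖]

theorem frobenius_isometry_sq {Q : Matrix (Fin m) (Fin n) ℝ} (hQ : Q.transpose * Q = 1) :
    ‖Q‖ ^ 2 = n := by
  rw [frobenius_sq_eq_trace, hQ]
  simp

/-- Mixed submultiplicativity: spectral norm on the left, Frobenius norm on the right. -/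
theorem frobenius_mul_le_opNorm_mul (E : Matrix (Fin n) (Fin k) ℝ) (M : Matrix (Fin k) (Fin m) ℝ) :
    ‖E * M‖ ≤ ‖euclideanOp E‖ * ‖M‖ := by
  refine (sq_le_sq₀ (norm_nonneg _) (by positivity)).1 ?_
  rw [mul_pow, ← frobenius_transpose, ← frobenius_transpose M, frobenius_sq, frobenius_sq,
    Finset.mul_sum]
  refine Finset.sum_le_sum fun j _ => ?_
  have h := (euclideanOp E).le_opNorm (WithLp.toLp 2 fun i => M i j)
  have h2 := pow_le_pow_left₀ (norm_nonneg _) h 2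
  rw [mul_pow, EuclideanSpace.real_norm_sq_eq, EuclideanSpace.real_norm_sq_eq] at h2
  simpa [euclideanOp_apply, Matrix.mul_apply] using h2

/-- The normal equations of the least-squares problem. -/
theorem normal_equations {L : Matrix (Fin n) (Fin k) ℝ} {A : Matrix (Fin n) (Fin d) ℝ}
    {W : Matrix (Fin k) (Fin d) ℝ} (h : ∀ Y : Matrix (Fin k) (Fin d) ℝ, ‖L * W - A‖ ≤ ‖L * Y - A‖) :
    L.transpose * (L * W - A) = 0 := by
  set G := L.transpose * (L * W - A) with hG
  have hquad : ∀ t : ℝ, 2 * t * ‖G‖ ^ 2 ≤ t ^ 2 * ‖L * G‖ ^ 2 := fun t => by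
    have h1 := pow_le_pow_left₀ (norm_nonneg _) (h (W - t • G)) 2
    have e : L * (W - t • G) - A = (L * W - A) - t • (L * G) := by
      rw [Matrix.mul_sub, Matrix.mul_smul]
      abel
    have e2 : ((L * W - A).transpose * (L * G)).trace = ‖G‖ ^ 2 := by
      rw [frobenius_sq_eq_trace, ← Matrix.mul_assoc]
      congr 2
      rw [hG, Matrix.transpose_mul, Matrix.transpose_transpose]
    rw [e, frobenius_sub_sq (L * W - A), Matrix.mul_smul, Matrix.trace_smul, e2, norm_smul, mul_pow,
      Real.norm_eq_abs, sq_abs, smul_eq_mul] at h1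
    linarith
  -- a step proportional to `‖G‖ ^ 2` makes the linear term dominate
  have h1 := hquad (‖G‖ ^ 2 / (‖L * G‖ ^ 2 + 1))
  have hpos : 0 < ‖L * G‖ ^ 2 + 1 := by positivity
  rw [div_pow, mul_div_assoc', div_mul_eq_mul_div, div_mul_eq_mul_div, div_le_div_iff₀ hpos
    (by positivity)] at h1
  have h2 : 2 * (‖G‖ ^ 2) ^ 2 * (‖L * G‖ ^ 2 + 1) ≤ (‖G‖ ^ 2) ^ 2 * ‖L * G‖ ^ 2 := by
    refine le_of_mul_le_mul_right ?_ hpos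
    linarith
  have h3 : (‖G‖ ^ 2) ^ 2 ≤ 0 := by
    nlinarith [mul_nonneg (sq_nonneg (‖G‖ ^ 2)) (sq_nonneg ‖L * G‖)]
  have h4 : (‖G‖ ^ 2) ^ 2 = 0 := le_antisymm h3 (sq_nonneg _)
  simpa using h4

end Frobenius

/-! ### The truncated singular value decomposition -/

/-- The rectangular diagonal matrix with diagonal entries `s 0, s 1, …`. -/
def rectDiag (n d : ℕ) (s : ℕ → ℝ) : Matrix (Fin n) (Fin d) ℝ :=
  Matrix.of fun i j => if (i : ℕ) = (j : ℕ) then s i else 0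

section SVD

variable {n d k m : ℕ}

theorem rectDiag_transpose (s : ℕ → ℝ) : (rectDiag n d s).transpose = rectDiag d n s := by
  ext i j
  simp only [rectDiag, Matrix.transpose_apply, Matrix.of_apply, eq_comm (a := (i : ℕ))]
  split_ifs with h
  · rw [h]
  · rfl

theorem rectDiag_mul_apply (s : ℕ → ℝ) (M : Matrix (Fin d) (Fin m) ℝ) (i : Fin n) (b : Fin m) :
    (rectDiag n d s * M) i b = if h : (i : ℕ) < d then s i * M ⟨i, h⟩ b else 0 := by
  rw [Matrix.mul_apply]
  split_ifs with h
  · rw [Finset.sum_eq_single ⟨i, h⟩]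
    · simp [rectDiag]
    · intro j _ hj
      have : (i : ℕ) ≠ j := fun e => hj (Fin.ext e.symm)
      simp [rectDiag, this]
    · simp
  · refine Finset.sum_eq_zero fun j _ => ?_
    have : (i : ℕ) ≠ j := fun e => h (e ▸ j.2)
    simp [rectDiag, this]

theorem frobenius_rectDiag_mul_sq {s : ℕ → ℝ} (hs : ∀ j < d, n ≤ j → s j = 0)
    (M : Matrix (Fin d) (Fin m) ℝ) :
    ‖rectDiag n d s * M‖ ^ 2 = ∑ j : Fin d, s j ^ 2 * ∑ b, M j b ^ 2 := by
  have h1 : ∀ i : Fin n, ∑ b, (rectDiag n d s * M) i b ^ 2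
      = ∑ j : Fin d, if (i : ℕ) = j then s j ^ 2 * ∑ b, M j b ^ 2 else 0 := fun i => by
    simp only [rectDiag_mul_apply]
    by_cases h : (i : ℕ) < d
    · rw [Finset.sum_eq_single (⟨i, h⟩ : Fin d)]
      · simp [h, mul_pow, Finset.mul_sum]
      · intro j _ hj
        rw [if_neg fun e => hj (Fin.ext e.symm)]
      · simp
    · rw [Finset.sum_eq_zero fun b _ => by simp [h], Finset.sum_eq_zero fun j _ => ?_]
      rw [if_neg fun e => h (by rw [e]; exact j.2)]
  rw [frobenius_sq, Finset.sum_congr rfl fun i _ => h1 i, Finset.sum_comm]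
  refine Finset.sum_congr rfl fun j _ => ?_
  by_cases h : (j : ℕ) < n
  · rw [Finset.sum_eq_single (⟨j, h⟩ : Fin n)]
    · simp
    · intro i _ hi
      rw [if_neg fun e => hi (Fin.ext e)]
    · simp
  · rw [hs j j.2 (not_lt.1 h)]
    simp

variable {A : Matrix (Fin n) (Fin d) ℝ} {U : Matrix (Fin n) (Fin n) ℝ}
  {V : Matrix (Fin d) (Fin d) ℝ}

theorem singularValue_nonneg (A : Matrix (Fin n) (Fin d) ℝ) (i : ℕ) : 0 ≤ singularValue A i :=
  LinearMap.singularValues_nonneg _ i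

theorem singularValue_antitone (A : Matrix (Fin n) (Fin d) ℝ) : Antitone (singularValue A) :=
  LinearMap.singularValues_antitone _

theorem singularValue_eq_zero_of_row_le (A : Matrix (Fin n) (Fin d) ℝ) {i : ℕ} (h : n ≤ i) :
    singularValue A i = 0 := by
  rw [singularValue, LinearMap.singularValues_eq_zero_iff_le_finrank_range]
  exact (Submodule.finrank_le _).trans (by simpa using h)

theorem singularValue_eq_zero_of_col_le (A : Matrix (Fin n) (Fin d) ℝ) {i : ℕ} (h : d ≤ i) :
    singularValue A i = 0 :=
  LinearMap.singularValues_of_finrank_le _ (by simpa using h)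

theorem IsSVD.left (h : IsSVD A U V) : U.transpose * U = 1 :=
  (Matrix.mem_orthogonalGroup_iff' (Fin n) ℝ).1 h.left_orthogonal

theorem IsSVD.right (h : IsSVD A U V) : V.transpose * V = 1 :=
  (Matrix.mem_orthogonalGroup_iff' (Fin d) ℝ).1 h.right_orthogonal

theorem IsSVD.right' (h : IsSVD A U V) : V * V.transpose = 1 :=
  (Matrix.mem_orthogonalGroup_iff (Fin d) ℝ).1 h.right_orthogonal

theorem IsSVD.left' (h : IsSVD A U V) : U * U.transpose = 1 :=
  (Matrix.mem_orthogonalGroup_iff (Fin n) ℝ).1 h.left_orthogonal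

theorem scaledLeftFactor_eq (A : Matrix (Fin n) (Fin d) ℝ) (U : Matrix (Fin n) (Fin n) ℝ)
    (hk : k ≤ d) : scaledLeftFactor A U hk = U * rectDiag n k (singularValue A) := by
  ext i j
  simp [scaledLeftFactor, sigmaMatrix, rectDiag, Matrix.mul_apply]

theorem IsSVD.frobenius_mul_le (h : IsSVD A U V) (M : Matrix (Fin d) (Fin m) ℝ) :
    ‖A * M‖ ≤ singularValue A 0 * ‖M‖ := by
  refine (sq_le_sq₀ (norm_nonneg _) (mul_nonneg (singularValue_nonneg A 0) (norm_nonneg _))).1 ?_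
  have e : ‖A * M‖ = ‖rectDiag n d (singularValue A) * (V.transpose * M)‖ := by
    conv_lhs => rw [h.eq_mul, Matrix.mul_assoc, Matrix.mul_assoc, frobenius_isometry_mul h.left]
    rfl
  have e2 : ‖M‖ = ‖V.transpose * M‖ := by
    rw [frobenius_isometry_mul]
    rw [Matrix.transpose_transpose, h.right']
  rw [e, e2, frobenius_rectDiag_mul_sq fun j _ hj => singularValue_eq_zero_of_row_le A hj, mul_pow,
    frobenius_sq, Finset.mul_sum]
  refine Finset.sum_le_sum fun j _ => mul_le_mul_of_nonneg_right ?_ (by positivity)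
  exact pow_le_pow_left₀ (singularValue_nonneg A _) (singularValue_antitone A (Nat.zero_le _)) 2

theorem le_row_of_singularValue_pos (h : 0 < singularValue A (k - 1)) : k ≤ n := by
  by_contra! hlt
  exact h.ne' (singularValue_eq_zero_of_row_le A (by omega))

theorem IsSVD.le_frobenius_scaledLeftFactor_mul (h : IsSVD A U V) (hk : k ≤ d)
    (hσ : 0 < singularValue A (k - 1)) (M : Matrix (Fin k) (Fin m) ℝ) :
    singularValue A (k - 1) * ‖M‖ ≤ ‖scaledLeftFactor A U hk * M‖ := by
  refine (sq_le_sq₀ (mul_nonneg hσ.le (norm_nonneg _)) (norm_nonneg _)).1 ?_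
  rw [scaledLeftFactor_eq, Matrix.mul_assoc, frobenius_isometry_mul h.left,
    frobenius_rectDiag_mul_sq fun j _ hj => singularValue_eq_zero_of_row_le A hj, mul_pow,
    frobenius_sq, Finset.mul_sum]
  refine Finset.sum_le_sum fun j _ => mul_le_mul_of_nonneg_right ?_ (by positivity)
  exact pow_le_pow_left₀ hσ.le (singularValue_antitone A (by omega)) 2

theorem IsSVD.frobenius_scaledLeftFactor_sq_le (h : IsSVD A U V) (hk : k ≤ d) :
    ‖scaledLeftFactor A U hk‖ ^ 2 ≤ k * singularValue A 0 ^ 2 := by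
  rw [scaledLeftFactor_eq, frobenius_isometry_mul h.left, ← Matrix.mul_one (rectDiag _ _ _),
    frobenius_rectDiag_mul_sq fun j _ hj => singularValue_eq_zero_of_row_le A hj]
  calc _ ≤ ∑ j : Fin k, singularValue A 0 ^ 2 := by
        refine Finset.sum_le_sum fun j _ => ?_
        rw [Finset.sum_eq_single j (fun b _ hb => by simp [hb.symm]) (by simp)]
        simpa using pow_le_pow_left₀ (singularValue_nonneg A _)
          (singularValue_antitone A (Nat.zero_le j)) 2
    _ = _ := by simp

/-- The first quantizer is never saturated. -/
theorem IsSVD.not_saturated_scaledLeftFactor (h : IsSVD A U V) (hk : k ≤ d) :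
    ¬ Saturated (singularValue A 0) (scaledLeftFactor A U hk) := by
  rintro ⟨i, j, hij⟩
  refine hij.not_ge (abs_le_of_sq_le_sq ?_ (singularValue_nonneg A 0))
  have h1 : ‖scaledLeftFactor A U hk *
      Matrix.of fun l (_ : Fin 1) => if l = j then (1 : ℝ) else 0‖ ^ 2
      ≤ singularValue A 0 ^ 2 := by
    rw [scaledLeftFactor_eq, Matrix.mul_assoc, frobenius_isometry_mul h.left,
      frobenius_rectDiag_mul_sq fun j _ hj => singularValue_eq_zero_of_row_le A hj]
    simpa using pow_le_pow_left₀ (singularValue_nonneg A _)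
          (singularValue_antitone A (Nat.zero_le j)) 2
  refine le_trans ?_ h1
  rw [frobenius_sq]
  simp only [Matrix.mul_apply, Matrix.of_apply, mul_ite, mul_one, mul_zero, Finset.sum_ite_eq',
    Finset.mem_univ, if_true, Finset.univ_unique, Finset.sum_const, Finset.card_singleton, one_smul]
  exact Finset.single_le_sum (f := fun l => scaledLeftFactor A U hk l j ^ 2)
    (fun _ _ => sq_nonneg _) (Finset.mem_univ i)

/-- If the quantization error is small in spectral norm, then the least singular value of the
quantized factor is at least `σ_k / 2`, and the second quantizer is not saturated. -/
theorem IsSVD.not_saturated_leastSquares (h : IsSVD A U V) (hk : k ≤ d)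
    (hσ : 0 < singularValue A (k - 1)) {E : Matrix (Fin n) (Fin k) ℝ}
    (hE : ‖euclideanOp E‖ ≤ singularValue A (k - 1) / 2) {W : Matrix (Fin k) (Fin d) ℝ}
    (hW : ∀ Y : Matrix (Fin k) (Fin d) ℝ,
      ‖(scaledLeftFactor A U hk + E) * W - A‖ ≤ ‖(scaledLeftFactor A U hk + E) * Y - A‖) :
    ¬ Saturated (2 * condNumber A k) W := by
  rintro ⟨i, j, hij⟩
  refine hij.not_ge ?_
  set L := scaledLeftFactor A U hk + E with hL
  set e : Matrix (Fin d) (Fin 1) ℝ := Matrix.of fun l _ => if l = j then 1 else 0 with he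
  have hne := normal_equations hW
  have hent : |W i j| ≤ ‖W * e‖ := by
    refine abs_le_of_sq_le_sq ?_ (norm_nonneg _)
    rw [frobenius_sq]
    simp only [he, Matrix.mul_apply, Matrix.of_apply, mul_ite, mul_one, mul_zero,
      Finset.sum_ite_eq', Finset.mem_univ, if_true, Finset.univ_unique, Finset.sum_const,
      Finset.card_singleton, one_smul]
    exact Finset.single_le_sum (f := fun l => W l j ^ 2) (fun _ _ => sq_nonneg _)
      (Finset.mem_univ i)
  have hecol : ‖e‖ ^ 2 = 1 := by simp [frobenius_sq, he]
  have hecol : ‖e‖ = 1 := by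
    nlinarith [norm_nonneg e]
  -- `L W e` is the orthogonal projection of `A e` onto the range of `L`
  have hproj : ‖L * (W * e)‖ ≤ ‖A * e‖ := by
    have h0 : ((L * (W * e)).transpose * (L * (W * e) - A * e)).trace = 0 := by
      rw [Matrix.transpose_mul, ← Matrix.mul_assoc L, ← Matrix.sub_mul, Matrix.mul_assoc,
        ← Matrix.mul_assoc L.transpose, hne]
      simp
    rw [Matrix.mul_sub, Matrix.trace_sub, ← frobenius_sq_eq_trace] at h0
    have h1 := frobenius_sub_sq (L * (W * e)) (A * e)
    refine (sq_le_sq₀ (norm_nonneg _) (norm_nonneg _)).1 ?_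
    nlinarith [sq_nonneg ‖L * (W * e) - A * e‖]
  have hlow : singularValue A (k - 1) / 2 * ‖W * e‖ ≤ ‖L * (W * e)‖ := by
    have h1 := h.le_frobenius_scaledLeftFactor_mul hk hσ (W * e)
    have h2 := (frobenius_mul_le_opNorm_mul E (W * e)).trans
      (mul_le_mul_of_nonneg_right hE (norm_nonneg _))
    have h3 : scaledLeftFactor A U hk * (W * e) = L * (W * e) - E * (W * e) := by
      rw [hL, Matrix.add_mul, add_sub_cancel_right]
    have h4 := norm_sub_le (L * (W * e)) (E * (W * e))
    rw [← h3] at h4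
    linarith
  have hA := h.frobenius_mul_le e
  rw [hecol, mul_one] at hA
  refine hent.trans ?_
  rw [condNumber, mul_div_assoc', le_div_iff₀ hσ]
  linarith

/-- The first `k` right singular vectors. -/
def rightFactor (V : Matrix (Fin d) (Fin d) ℝ) (hk : k ≤ d) : Matrix (Fin d) (Fin k) ℝ :=
  V.submatrix id (Fin.castLE hk)

theorem IsSVD.rightFactor_isometry (h : IsSVD A U V) (hk : k ≤ d) :
    (rightFactor V hk).transpose * rightFactor V hk = 1 := by
  ext i j
  have h1 := congrFun (congrFun h.right (Fin.castLE hk i)) (Fin.castLE hk j)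
  simp only [Matrix.mul_apply, Matrix.transpose_apply, Matrix.one_apply, Fin.castLE_inj] at h1
  simpa [Matrix.mul_apply, rightFactor, Matrix.one_apply] using h1

theorem IsSVD.frobenius_truncation_sq (h : IsSVD A U V) (hk : k ≤ d) :
    ‖scaledLeftFactor A U hk * (rightFactor V hk).transpose - A‖ ^ 2
      = ∑ j : Fin n, if (j : ℕ) < k then 0 else singularValue A j ^ 2 := by
  have e : scaledLeftFactor A U hk * (rightFactor V hk).transpose
      = U * rectDiag n d (fun i => if i < k then singularValue A i else 0) * V.transpose := by
    rw [scaledLeftFactor_eq, Matrix.mul_assoc, Matrix.mul_assoc]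
    congr 1
    ext i b
    rw [rectDiag_mul_apply, rectDiag_mul_apply]
    by_cases hi : (i : ℕ) < k
    · simp [hi, hi.trans_le hk, rightFactor]
    · simp [hi]
  have e2 : U * rectDiag n d (fun i => if i < k then singularValue A i else 0) * V.transpose - A
      = U * rectDiag n d (fun i => if i < k then 0 else -singularValue A i) * V.transpose := by
    conv_lhs => rhs; rw [h.eq_mul]
    rw [← Matrix.sub_mul, ← Matrix.mul_sub]
    congr 2
    ext i j
    simp only [rectDiag, sigmaMatrix, Matrix.sub_apply, Matrix.of_apply]
    split_ifs <;> simp_all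
  rw [e, e2, frobenius_mul_isometry_transpose h.right, frobenius_isometry_mul h.left,
    ← frobenius_transpose, rectDiag_transpose, ← Matrix.mul_one (rectDiag d n _),
    frobenius_rectDiag_mul_sq fun j _ hj => by simp [singularValue_eq_zero_of_col_le A hj]]
  refine Finset.sum_congr rfl fun j _ => ?_
  rw [Finset.sum_eq_single j (fun b _ hb => by simp [hb.symm]) (by simp)]
  split_ifs <;> simp

/-- An orthonormal basis of the range of `M`, as the columns of a matrix. -/
theorem exists_isometry_factorization (M : Matrix (Fin n) (Fin d) ℝ) :
    ∃ (Q : Matrix (Fin n) (Fin M.rank) ℝ) (Y : Matrix (Fin M.rank) (Fin d) ℝ),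
      Q.transpose * Q = 1 ∧ M = Q * Y := by
  set K := LinearMap.range (Matrix.toEuclideanLin M) with hK
  have hr : Module.finrank ℝ K = M.rank := by
    rw [hK, Matrix.rank_eq_finrank_range_toLin M (EuclideanSpace.basisFun (Fin n) ℝ).toBasis
      (EuclideanSpace.basisFun (Fin d) ℝ).toBasis]
    rfl
  let q := (stdOrthonormalBasis ℝ K).reindex (finCongr hr)
  have hmem : ∀ j, Matrix.toEuclideanLin M (EuclideanSpace.single j 1) ∈ K := fun j => ⟨_, rfl⟩
  refine ⟨Matrix.of fun i l => (q l : EuclideanSpace ℝ (Fin n)) i,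
    Matrix.of fun l j => q.repr ⟨_, hmem j⟩ l, ?_, ?_⟩
  · ext a b
    have := orthonormal_iff_ite.1 q.orthonormal a b
    rw [Submodule.coe_inner, PiLp.inner_apply] at this
    simp only [Matrix.mul_apply, Matrix.transpose_apply, Matrix.of_apply, Matrix.one_apply]
    rw [← this]
    exact Finset.sum_congr rfl fun i _ => by simp [mul_comm]
  · ext i j
    have h1 := congrArg (fun v : K => (v : EuclideanSpace ℝ (Fin n)) i) (q.sum_repr ⟨_, hmem j⟩)
    simp only [Submodule.coe_sum, Submodule.coe_smul] at h1
    simp only [Matrix.mul_apply, Matrix.of_apply]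
    have h2 : Matrix.toEuclideanLin M (EuclideanSpace.single j 1) i = M i j := by
      simp [Matrix.toLpLin_apply]
    rw [← h2, ← h1, WithLp.ofLp_sum, Finset.sum_apply]
    exact Finset.sum_congr rfl fun l _ => mul_comm _ _

/-- The Eckart–Young inequality in Frobenius norm. Projecting `A` onto the range of `M` captures at
most `∑ σ_j² g_j`, where the weights `g_j` lie in `[0, 1]` and sum to at most `k`; such a sum is
largest when the weight is on the first `k` indices. -/
theorem IsSVD.frobenius_truncation_sq_le (h : IsSVD A U V) (hk : k ≤ d) (hkn : k ≤ n)
    {M : Matrix (Fin n) (Fin d) ℝ} (hM : M.rank ≤ k) :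
    ‖scaledLeftFactor A U hk * (rightFactor V hk).transpose - A‖ ^ 2 ≤ ‖M - A‖ ^ 2 := by
  obtain ⟨Q, Y, hQ, hMQ⟩ := exists_isometry_factorization M
  have hdist : ‖A‖ ^ 2 - ‖Q.transpose * A‖ ^ 2 ≤ ‖M - A‖ ^ 2 := by
    conv_rhs => rw [hMQ]
    rw [frobenius_isometry_mul_sub_sq hQ]
    nlinarith [sq_nonneg ‖Y - Q.transpose * A‖]
  refine le_trans ?_ hdist
  -- `g j` is the squared length of the projection of the `j`-th left singular vector
  set g : Fin n → ℝ := fun j => ∑ l, (Q.transpose * U) l j ^ 2 with hg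
  have hg0 : ∀ j, 0 ≤ g j := fun j => Finset.sum_nonneg fun _ _ => sq_nonneg _
  have hg1 : ∀ j, g j ≤ 1 := fun j => by
    have h1 := frobenius_isometry_transpose_mul_sq_le hQ
      (U * Matrix.of fun l (_ : Fin 1) => if l = j then (1 : ℝ) else 0)
    rw [frobenius_isometry_mul h.left, ← Matrix.mul_assoc, frobenius_sq, frobenius_sq] at h1
    simpa [Matrix.mul_apply (M := Q.transpose * U)] using h1
  have hgsum : ∑ j, g j ≤ k := by
    have h1 : ∑ j, g j = ‖Q.transpose * U‖ ^ 2 := by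
      rw [frobenius_sq, Finset.sum_comm]
    have h2 : ‖Q.transpose * U‖ = ‖Q‖ := by
      rw [← frobenius_transpose Q, ← Matrix.transpose_transpose U, frobenius_mul_isometry_transpose]
      rw [Matrix.transpose_transpose, h.left']
    rw [h1, h2, frobenius_isometry_sq hQ]
    exact_mod_cast hM
  have hA : ‖A‖ ^ 2 = ∑ j : Fin n, singularValue A j ^ 2 := by
    have := h.frobenius_truncation_sq (Nat.zero_le d)
    have e : scaledLeftFactor A U (Nat.zero_le d) *
        (rightFactor V (Nat.zero_le d)).transpose = 0 := by
      ext i j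
      simp [Matrix.mul_apply]
    rw [e, zero_sub, norm_neg] at this
    simpa using this
  have hQA : ‖Q.transpose * A‖ ^ 2 = ∑ j : Fin n, singularValue A j ^ 2 * g j := by
    have e : Q.transpose * A =
        (Q.transpose * U * rectDiag n d (singularValue A)) * V.transpose := by
      conv_lhs => rw [h.eq_mul]
      simp only [Matrix.mul_assoc]
      rfl
    rw [e, frobenius_mul_isometry_transpose h.right, ← frobenius_transpose, Matrix.transpose_mul,
      rectDiag_transpose,
      frobenius_rectDiag_mul_sq fun j _ hj => singularValue_eq_zero_of_col_le A hj]
    rfl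
  rw [h.frobenius_truncation_sq, hA, hQA, ← Finset.sum_sub_distrib]
  -- compare every term with the threshold `σ_{k+1} ^ 2`
  have hterm : ∀ j : Fin n, (if (j : ℕ) < k then 0 else singularValue A j ^ 2) ≤
      singularValue A j ^ 2 - singularValue A j ^ 2 * g j
        + singularValue A k ^ 2 * (g j - if (j : ℕ) < k then 1 else 0) := fun j => by
    split_ifs with hj
    · have := pow_le_pow_left₀ (singularValue_nonneg A k) (singularValue_antitone A hj.le) 2
      nlinarith [hg1 j]
    · have := pow_le_pow_left₀ (singularValue_nonneg A j) (singularValue_antitone A (not_lt.1 hj)) 2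
      nlinarith [hg0 j]
  refine (Finset.sum_le_sum fun j _ => hterm j).trans ?_
  rw [Finset.sum_add_distrib, ← Finset.mul_sum,
    Finset.sum_sub_distrib (fun j => g j)]
  have hcard : ∑ j : Fin n, (if (j : ℕ) < k then (1 : ℝ) else 0) = k := by
    rw [Finset.sum_boole]
    simp [Fin.card_filter_val_lt, hkn]
  rw [hcard]
  nlinarith [sq_nonneg (singularValue A k)]

end SVD

/-! ### Quantization errors of the algorithm -/

/-- Independent centred errors add only their variance, at most `1 / 4` per entry, to the mean
squared Frobenius norm. -/
theorem productMean_frobenius_sq_le {n d m k : ℕ} (r : Fin m × Fin k → ℝ) (c : ℝ)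
    (G : Matrix (Fin n) (Fin d) ℝ) (P : Matrix (Fin n) (Fin m) ℝ) (N : Matrix (Fin k) (Fin d) ℝ) :
    productMean r (fun b => ‖G + c • (P * ditherMatrix r b * N)‖ ^ 2)
      ≤ ‖G‖ ^ 2 + c ^ 2 / 4 * (‖P‖ ^ 2 * ‖N‖ ^ 2) := by
  have e : ∀ b i j, (G + c • (P * ditherMatrix r b * N)) i j
      = G i j + ∑ q : Fin m × Fin k, (c * P i q.1 * N q.2 j) * ditherError (r q) (b q) :=
    fun b i j => by
      simp only [Matrix.add_apply, Matrix.smul_apply, Matrix.mul_apply, ditherMatrix,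
        Matrix.of_apply, smul_eq_mul, Fintype.sum_prod_type, Finset.sum_mul, Finset.mul_sum]
      rw [Finset.sum_comm]
      congr 1
      exact Finset.sum_congr rfl fun _ _ => Finset.sum_congr rfl fun _ _ => by ring
  simp only [frobenius_sq (G + _), e, productMean_sum]
  refine (Finset.sum_le_sum fun i _ => Finset.sum_le_sum fun j _ =>
    productMean_affine_sq_le r (G i j) _).trans (le_of_eq ?_)
  simp only [Finset.sum_add_distrib, ← frobenius_sq]
  congr 1
  rw [frobenius_sq P, frobenius_sq N, Finset.sum_comm (γ := Fin k), Finset.sum_mul, Finset.mul_sum]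
  refine Finset.sum_congr rfl fun i _ => ?_
  rw [Finset.mul_sum, Finset.mul_sum]
  refine Finset.sum_congr rfl fun j _ => ?_
  rw [Finset.sum_mul_sum, Fintype.sum_prod_type, Finset.sum_div, Finset.mul_sum]
  refine Finset.sum_congr rfl fun a _ => ?_
  rw [Finset.sum_div, Finset.mul_sum]
  exact Finset.sum_congr rfl fun b _ => by ring

theorem frobenius_one_sq (n : ℕ) : ‖(1 : Matrix (Fin n) (Fin n) ℝ)‖ ^ 2 = n :=
  frobenius_isometry_sq (by simp)

theorem le_two_pow_of_logb_le {x : ℝ} {B : ℕ} (hx : 0 < x) (h : Real.logb 2 (x + 1) ≤ B) :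
    x + 1 ≤ 2 ^ B := by
  rwa [Real.logb_le_iff_le_rpow one_lt_two (by linarith), Real.rpow_natCast] at h

theorem resolution_pos {R x : ℝ} {B : ℕ} (hR : 0 < R) (hx : 0 < x) (h : x + 1 ≤ 2 ^ B) :
    0 < resolution R B :=
  div_pos (by linarith) (by linarith)

theorem resolution_mul_le {R x : ℝ} {B : ℕ} (hR : 0 < R) (hx : 0 < x) (h : x + 1 ≤ 2 ^ B) :
    resolution R B * x ≤ 2 * R := by
  rw [resolution, div_mul_eq_mul_div, div_le_iff₀ (by linarith)]
  exact mul_le_mul_of_nonneg_left (by linarith) (by linarith)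

open Classical in
/-- The conditional expectation of the squared error given the first factor `L`: the second
quantizer is unbiased, and saturation costs `‖A‖ ^ 2`. -/
theorem expectation_second_factor_le {n d k : ℕ} (A : Matrix (Fin n) (Fin d) ℝ)
    (L : Matrix (Fin n) (Fin k) ℝ) (W : Matrix (Fin k) (Fin d) ℝ) {R : ℝ} {B : ℕ}
    (h : resolution R B ≠ 0) :
    expectation (if Saturated R W then PMF.pure (0, 0) else (quantize R B W).map fun Z => (L, Z))
        (fun LR : Matrix (Fin n) (Fin k) ℝ × Matrix (Fin k) (Fin d) ℝ =>
          ENNReal.ofReal (‖LR.1 * LR.2 - A‖ ^ 2))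
      ≤ ENNReal.ofReal (‖L * W - A‖ ^ 2 + resolution R B ^ 2 / 4 * d * ‖L‖ ^ 2
          + if Saturated R W then ‖A‖ ^ 2 else 0) := by
  split_ifs with hs
  · rw [expectation_pure]
    refine ENNReal.ofReal_le_ofReal ?_
    simp only [Matrix.mul_zero, zero_sub, norm_neg]
    have : 0 ≤ ‖L * W - A‖ ^ 2 + resolution R B ^ 2 / 4 * d * ‖L‖ ^ 2 := by positivity
    linarith
  · rw [expectation_map, add_zero]
    refine (expectation_quantize h W (g := fun Z => ‖L * Z - A‖ ^ 2)
      fun _ => sq_nonneg _).trans_le (ENNReal.ofReal_le_ofReal ?_)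
    have e := productMean_frobenius_sq_le (fun p : Fin k × Fin d => upProb R B (W p.1 p.2))
      (resolution R B) (L * W - A) L 1
    rw [frobenius_one_sq] at e
    refine le_trans (le_of_eq ?_) (e.trans (le_of_eq (by ring)))
    congr 1
    funext b
    rw [Matrix.mul_one, Matrix.mul_add, Matrix.mul_smul, add_sub_right_comm]

theorem frobenius_sq_le_of_row_le {n d : ℕ} {A : Matrix (Fin n) (Fin d) ℝ} {R : ℝ}
    (h : ∀ i, ‖(WithLp.toLp 2 (A i) : EuclideanSpace ℝ (Fin d))‖ ≤ R) : ‖A‖ ^ 2 ≤ n * R ^ 2 := by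
  rw [frobenius_sq]
  calc _ ≤ ∑ _i : Fin n, R ^ 2 := Finset.sum_le_sum fun i _ => by
        have := pow_le_pow_left₀ (norm_nonneg _) (h i) 2
        rwa [EuclideanSpace.real_norm_sq_eq] at this
    _ = _ := by simp

/-- When the logarithm is negative its square root is `0`, and the bound holds because `8 * a` is
then at most `ε`. -/
theorem mul_exp_neg_sqrt_log_sq_le {a ε : ℝ} (ha : 0 < a) (hε : 0 < ε) :
    a * Real.exp (-Real.sqrt (Real.log (8 * a / ε)) ^ 2) ≤ ε / 8 := by
  rcases le_total 0 (Real.log (8 * a / ε)) with h | h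
  · rw [Real.sq_sqrt h, Real.exp_neg, Real.exp_log (by positivity)]
    exact le_of_eq (by field_simp)
  · have h1 := (Real.log_nonpos_iff (by positivity)).1 h
    rw [div_le_one hε] at h1
    have h2 : Real.exp (-Real.sqrt (Real.log (8 * a / ε)) ^ 2) ≤ 1 :=
      Real.exp_le_one_iff.2 (by simp only [Left.neg_nonpos_iff]; positivity)
    nlinarith

open Classical in
/-- The mean over the first quantizer of the bound in `expectation_second_factor_le`: the excess over
the error of the truncated singular value decomposition is at most `ε / 4` from the error of the
first factor, `ε / 2` from the variance of the second, and `ε / 8` from saturation. -/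
theorem IsSVD.productMean_le {n d k : ℕ} {A : Matrix (Fin n) (Fin d) ℝ}
    {U : Matrix (Fin n) (Fin n) ℝ} {V : Matrix (Fin d) (Fin d) ℝ} (hSVD : IsSVD A U V) (hk : k ≤ d)
    (hσk : 0 < singularValue A (k - 1))
    {W : Matrix (Fin n) (Fin k) ℝ → Matrix (Fin k) (Fin d) ℝ} (hW : IsLeastSquaresSolver A W)
    {ε Δ Δ' t : ℝ} (hΔ0 : 0 < Δ) (ht0 : 0 ≤ t)
    (hεk : ε < 4 * k * singularValue A 0 ^ 2)
    (hΔ1 : Δ ^ 2 * (n * k) ≤ ε)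
    (hΔ2 : 16 * (Real.sqrt n + Real.sqrt k + t) * Δ ≤ singularValue A (k - 1) / 2)
    (hΔ3 : Δ' ^ 2 * d * (k * singularValue A 0 ^ 2) ≤ ε)
    (hsat : ‖A‖ ^ 2 * Real.exp (-t ^ 2) ≤ ε / 8)
    {r : Fin n × Fin k → ℝ} (hr : ∀ p, r p ∈ Set.Icc (0 : ℝ) 1) :
    productMean r (fun b =>
        ‖(scaledLeftFactor A U hk + Δ • ditherMatrix r b)
            * W (scaledLeftFactor A U hk + Δ • ditherMatrix r b) - A‖ ^ 2
        + Δ' ^ 2 / 4 * d * ‖scaledLeftFactor A U hk + Δ • ditherMatrix r b‖ ^ 2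
        + if Saturated (2 * condNumber A k) (W (scaledLeftFactor A U hk + Δ • ditherMatrix r b))
          then ‖A‖ ^ 2 else 0)
      ≤ ‖scaledLeftFactor A U hk * (rightFactor V hk).transpose - A‖ ^ 2 + 7 / 8 * ε := by
  set X := scaledLeftFactor A U hk with hX
  set N := (rightFactor V hk).transpose with hN
  set σ := singularValue A 0
  set τ := singularValue A (k - 1)
  set κ := condNumber A k
  set T := Real.sqrt n + Real.sqrt k + t
  -- compare the least-squares solution with `Vₖᵀ`, and contain saturation in the event that the
  -- spectral norm of the error is large
  have hpt : ∀ b, ‖(X + Δ • ditherMatrix r b) * W (X + Δ • ditherMatrix r b) - A‖ ^ 2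
        + Δ' ^ 2 / 4 * d * ‖X + Δ • ditherMatrix r b‖ ^ 2
        + (if Saturated (2 * κ) (W (X + Δ • ditherMatrix r b)) then ‖A‖ ^ 2 else 0)
      ≤ (‖X * N - A + Δ • ((1 : Matrix (Fin n) (Fin n) ℝ) * ditherMatrix r b * N)‖ ^ 2
        + Δ' ^ 2 / 4 * d * ‖X + Δ • ((1 : Matrix (Fin n) (Fin n) ℝ) * ditherMatrix r b *
              (1 : Matrix (Fin k) (Fin k) ℝ))‖ ^ 2)
        + ‖A‖ ^ 2 * (if 16 * T < ‖euclideanOp (ditherMatrix r b)‖ then 1 else 0) := by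
    intro b
    rw [Matrix.one_mul, Matrix.mul_one]
    have h1 : ‖(X + Δ • ditherMatrix r b) * W (X + Δ • ditherMatrix r b) - A‖
        ≤ ‖X * N - A + Δ • (ditherMatrix r b * N)‖ := by
      refine (hW _ N).trans (le_of_eq ?_)
      rw [Matrix.add_mul, Matrix.smul_mul, add_sub_right_comm]
    refine add_le_add (add_le_add (pow_le_pow_left₀ (norm_nonneg _) h1 2) le_rfl) ?_
    by_cases hop : 16 * T < ‖euclideanOp (ditherMatrix r b)‖
    · rw [if_pos hop, mul_one]
      split_ifs
      · exact le_rfl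
      · positivity
    · have hE : ‖euclideanOp (Δ • ditherMatrix r b)‖ ≤ τ / 2 := by
        have e : euclideanOp (Δ • ditherMatrix r b)
            = Δ • euclideanOp (ditherMatrix r b) := by
          simp [euclideanOp]
        rw [e, norm_smul, Real.norm_eq_abs, abs_of_pos hΔ0]
        nlinarith [not_lt.1 hop]
      rw [if_neg (hSVD.not_saturated_leastSquares hk hσk hE (hW _)), if_neg hop, mul_zero]
  refine (productMean_mono hr hpt).trans ?_
  rw [productMean_add, productMean_add, productMean_const_mul,
    productMean_const_mul]
  have hm1 := productMean_frobenius_sq_le r Δ (X * N - A) 1 N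
  have hm2 := productMean_frobenius_sq_le r Δ X 1 1
  have hm3 := productMean_opNorm_tail hr ht0
  have hN2 : ‖N‖ ^ 2 = k := by
    rw [hN, frobenius_transpose, frobenius_isometry_sq (hSVD.rightFactor_isometry hk)]
  rw [frobenius_one_sq, hN2] at hm1
  rw [frobenius_one_sq, frobenius_one_sq] at hm2
  have hXk : ‖X‖ ^ 2 ≤ k * σ ^ 2 := hSVD.frobenius_scaledLeftFactor_sq_le hk
  -- the second moment of the first factor is at most `k σ₁² + ε / 4`, which is at most `2 k σ₁²`
  have hL := mul_le_mul_of_nonneg_left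
    (hm2.trans (by linarith only [hXk, hΔ1, hεk] : _ ≤ 2 * (k * σ ^ 2)))
    (by positivity : 0 ≤ Δ' ^ 2 / 4 * d)
  have hm3' := mul_le_mul_of_nonneg_left hm3 (sq_nonneg ‖A‖)
  linarith only [hm1, hL, hm3', hsat, hΔ1, hΔ3]

end LPLR

/-! ### The error bound -/

theorem mainTheorem3 :
    ∃ C : ℝ, 0 < C ∧
      ∀ (n d k : ℕ) (hk : k ≤ d)
        (A Ak : Matrix (Fin n) (Fin d) ℝ)
        (U : Matrix (Fin n) (Fin n) ℝ) (V : Matrix (Fin d) (Fin d) ℝ)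
        (W : Matrix (Fin n) (Fin k) ℝ → Matrix (Fin k) (Fin d) ℝ)
        (R ε : ℝ) (B B' : ℕ),
        LPLR.IsSVD A U V →
        LPLR.IsBestRankApprox A k Ak →
        LPLR.IsLeastSquaresSolver A W →
        0 < LPLR.singularValue A (k - 1) →
        0 < R →
        (∀ i, ‖(WithLp.toLp 2 (A i) : EuclideanSpace ℝ (Fin d))‖ ≤ R) →
        0 < ε →
        ε < 4 * k * LPLR.singularValue A 0 ^ 2 →
        max
          (Real.logb 2 (2 * LPLR.singularValue A 0 * Real.sqrt (n * k / ε) + 1))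
          (Real.logb 2
            (4 * C * LPLR.condNumber A k / Real.log 2
              * (Real.sqrt n + Real.sqrt k + Real.sqrt (Real.log (8 * n * R ^ 2 / ε))) + 1))
          ≤ (B : ℝ) →
        Real.logb 2
          (4 * LPLR.singularValue A 0 * LPLR.condNumber A k * Real.sqrt (d * k / ε) + 1)
          ≤ (B' : ℝ) →
        LPLR.expectation
          (LPLR.lplrSvd A U hk
            (LPLR.singularValue A 0) (2 * LPLR.condNumber A k) B B' W)
          (fun LR => ENNReal.ofReal (‖LR.1 * LR.2 - A‖ ^ 2))
          ≤ ENNReal.ofReal (‖Ak - A‖ ^ 2 + ε) := by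
  classical
  -- `16` is the constant of the spectral norm bound `productMean_opNorm_tail`
  refine ⟨16, by norm_num, fun n d k hk A Ak U V W R ε B B' hSVD hbest hW hσk hR hrow hε hεk hB
    hB' => ?_⟩
  have hkn : k ≤ n := LPLR.le_row_of_singularValue_pos hσk
  have hk0 : 0 < k := by
    rcases Nat.eq_zero_or_pos k with rfl | h
    · simp at hεk
      linarith
    · exact h
  set σ := LPLR.singularValue A 0 with hσ
  set τ := LPLR.singularValue A (k - 1) with hτ
  have hσ0 : 0 < σ := hσk.trans_le (LPLR.singularValue_antitone A (Nat.zero_le _))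
  set κ := LPLR.condNumber A k with hκ
  have hκσ : κ * τ = σ := div_mul_cancel₀ _ hσk.ne'
  have hκ0 : 0 < κ := div_pos hσ0 hσk
  have hkR : (0 : ℝ) < k := by exact_mod_cast hk0
  have hnR : (0 : ℝ) < n := by exact_mod_cast hk0.trans_le hkn
  have hdR : (0 : ℝ) < d := by exact_mod_cast hk0.trans_le hk
  set t := Real.sqrt (Real.log (8 * n * R ^ 2 / ε)) with ht
  have ht0 : 0 ≤ t := Real.sqrt_nonneg _
  set T := Real.sqrt n + Real.sqrt k + t with hT
  have hT0 : 0 < T := by positivity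
  have hlog2 : 0 < Real.log 2 := Real.log_pos one_lt_two
  have hlog2' : Real.log 2 ≤ 1 := by linarith [Real.log_two_lt_d9]
  set Δ := LPLR.resolution σ B with hΔ
  set Δ' := LPLR.resolution (2 * κ) B' with hΔ'
  have hx1 : 0 < 2 * σ * Real.sqrt (n * k / ε) := by positivity
  have hx2 : 0 < 4 * 16 * κ / Real.log 2 * T := by positivity
  have hx3 : 0 < 4 * σ * κ * Real.sqrt (d * k / ε) := by positivity
  have hB1 := LPLR.le_two_pow_of_logb_le hx1 ((le_max_left _ _).trans hB)
  have hB2 := LPLR.le_two_pow_of_logb_le hx2 ((le_max_right _ _).trans hB)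
  have hB3 := LPLR.le_two_pow_of_logb_le hx3 hB'
  have hΔ0 : 0 < Δ := LPLR.resolution_pos hσ0 hx1 hB1
  have hΔ'0 : 0 < Δ' := LPLR.resolution_pos (by positivity) hx3 hB3
  -- besides positivity of the resolutions, the bit budgets enter only through three bounds
  have hΔ1 : Δ ^ 2 * (n * k) ≤ ε := by
    have h1 : Δ * Real.sqrt (n * k / ε) ≤ 1 := by
      have := LPLR.resolution_mul_le hσ0 hx1 hB1
      refine le_of_mul_le_mul_right ?_ (by positivity : 0 < 2 * σ)
      linarith
    have h2 := pow_le_pow_left₀ (by positivity) h1 2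
    rw [mul_pow, Real.sq_sqrt (by positivity), one_pow, mul_div_assoc', div_le_one hε] at h2
    exact h2
  have hΔ2 : 16 * T * Δ ≤ τ / 2 := by
    have h1 := LPLR.resolution_mul_le hσ0 hx2 hB2
    rw [div_mul_eq_mul_div, mul_div_assoc', div_le_iff₀ hlog2, ← hΔ] at h1
    have h2 : 16 * T * Δ ≤ τ / 2 * Real.log 2 := by
      refine le_of_mul_le_mul_right ?_ (by positivity : 0 < 4 * κ)
      rw [← hκσ] at h1
      linarith
    nlinarith
  have hΔ3 : Δ' ^ 2 * d * (k * σ ^ 2) ≤ ε := by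
    have h1 : Δ' * σ * Real.sqrt (d * k / ε) ≤ 1 := by
      have := LPLR.resolution_mul_le (R := 2 * κ) (by positivity) hx3 hB3
      refine le_of_mul_le_mul_right ?_ (by positivity : 0 < 4 * κ)
      linarith
    have h2 := pow_le_pow_left₀ (by positivity) h1 2
    rw [mul_pow, Real.sq_sqrt (by positivity), one_pow, mul_div_assoc', div_le_one hε] at h2
    linarith
  have hsat : ‖A‖ ^ 2 * Real.exp (-t ^ 2) ≤ ε / 8 := by
    refine (mul_le_mul_of_nonneg_right (LPLR.frobenius_sq_le_of_row_le hrow)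
      (Real.exp_nonneg _)).trans ?_
    have := LPLR.mul_exp_neg_sqrt_log_sq_le (a := n * R ^ 2) (by positivity) hε
    rwa [← mul_assoc] at this
  rw [LPLR.lplrSvd, if_neg (hSVD.not_saturated_scaledLeftFactor hk), LPLR.expectation_bind]
  refine (LPLR.expectation_mono _ fun L =>
    LPLR.expectation_second_factor_le A L (W L) hΔ'0.ne').trans ?_
  rw [LPLR.expectation_quantize hΔ0.ne' _ fun L => by positivity]
  refine ENNReal.ofReal_le_ofReal ?_
  refine (hSVD.productMean_le hk hσk hW hΔ0 ht0 hεk hΔ1 hΔ2 hΔ3 hsat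
    fun p => LPLR.upProb_mem _ _ _).trans ?_
  have hAk := hSVD.frobenius_truncation_sq_le hk hkn hbest.rank_le
  linarith only [hAk, hε]
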